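/- A quasi-metric space is a set $X$ with a function $d:X\times X\to[0,\infty)$ (not necessarily symmetric) such that $d(x,x)=0$, $d(x,z)\le d(x,y)+d(y,z)$, and $d(x,y)>0$ whenever $x\ne y$. Notation. Let $\mathbf A$ be the category of $\mathbb R$-graded abelian groups and let $\mathrm{Ch}_{\mathbf A}$ be the category of non-negatively graded chain complexes in $\mathbf A$. For $\ell\ge 0$ let $\Sigma(\ell)\in\mathbf A$ be $\mathbb Z$ in grading $\ell$ and $0$ in every other grading; this is a functor on $[0,\infty)$ (with a morphism $\ell\to m$ exactly when $\ell\ge m$), strong monoidal from $+$ to the convolution tensor product of $\mathbf A$. For $X$ with distance $d$, the magnitude nerve $B_\bullet(\Sigma X,\mathbb 1)$ is the simplicial object of $\mathbf A$ with $$B_n(\Sigma X,\mathbb 1)=\coprod_{x_0,\dots,x_n\in X}B_{x_0,\dots,x_n},\qquad B_{x_0,\dots,x_n}=\Sigma(d(x_0,x_1))\otimes\cdots\otimes\Sigma(d(x_{n-1},x_n))\otimes\Sigma(0)\cong\Sigma\big(d(x_0,x_1)+\cdots+d(x_{n-1},x_n)\big),$$ whose degeneracies repeat a point, and whose faces discard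 a point when this does not change the total length and are $0$ otherwise. The realized magnitude nerve $B(\Sigma X,\mathbb 1)\in\mathrm{Ch}_{\mathbf A}$ is its geometric realization, i.e. its normalized chain complex $n\mapsto B_n/L_nB$, where $L_nB$ is the latching object (the colimit over all degeneracies into $B_n$). Let $L_{x_0,\dots,x_n}B$ be the colimit of the summands of the sources of all proper degeneracy maps that map into the summand $B_{x_0,\dots,x_n}$. A complex $C\in\mathrm{Ch}_{\mathbf A}$ is Hahn finite if in each grading $\ell\in\mathbb R$ the complex $C_\ell$ is quasi-isomorphic to a bounded complex of finitely generated free abelian groups and the set of $\ell$ with $\chi(C)_\ell:=\sum_n(-1)^n\,\mathrm{rk}\,H_n(C_\ell)\ne0$ is well-ordered; then $\chi(C)=\sum_\ell\chi(C)_\ell\,q^\ell$ is an element of the Hahn series field $\mathbb Q((q^{\mathbb R}))$, which carries the topology of the valuation given by the smallest exponent with non-zero coefficient. Graded abelian groups are regarded as complexes concentrated in degree $0$, and the weight of a tuple is $$w(x_0,\dots,x_n)=\chi(B_{x_0,\dots,x_n})-\chi(L_{x_0,\dots,x_n}B).$$ Theorem. Every finite quasi-metric space $X$ has convergent magnitude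 Euler characteristic with respect to $\chi$. That is, all $B_{x_0,\dots,x_n}$ and $L_{x_0,\dots,x_n}B$ are Hahn finite (so that the weights are defined), and: 1. $B(\Sigma X,\mathbb 1)$ is Hahn finite. 2. For all $a,b\in X$ the series $\displaystyle\sum_{n=0}^\infty(-1)^n\sum_{x_0=a,\;x_1,\dots,x_{n-1}\in X,\;x_n=b}w(x_0,\dots,x_n)$ converges in $\mathbb Q((q^{\mathbb R}))$. 3. The series $\displaystyle\sum_{n=0}^\infty(-1)^n\sum_{x_0,\dots,x_n\in X}w(x_0,\dots,x_n)$ converges in $\mathbb Q((q^{\mathbb R}))$ to $\chi(B(\Sigma X,\mathbb 1))$. -/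

import Mathlib

open CategoryTheory Limits Opposite Filter Topology
open scoped NNReal

universe u

namespace MagnitudeHomology

/-! ### Quasi-metric spaces -/

/-- A (small) category enriched over `[0,∞)` with the opposite ordering and monoidal structure `+`,
i.e. a quasi-pseudo-metric space. Symmetry of `d` is not required. -/
class QuasiPseudoMetric (X : Type u) where
  /-- the distance, i.e. the hom-object from `x` to `y` -/
  d : X → X → ℝ≥0
  d_self : ∀ x, d x x = 0
  d_triangle : ∀ x y z, d x z ≤ d x y + d y z

open QuasiPseudoMetric

/-- A quasi-metric space: distinct points are at positive distance. -/
def IsQuasiMetric (X : Type u) [QuasiPseudoMetric X] : Prop :=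
  ∀ x y : X, x ≠ y → 0 < d x y

/-! ### Latching objects, fibrewise coproducts, normalized chains -/

section General

variable {E : Type*} [Category E] {A : Type*} [Category A]

/-- For a category `E` over `Δᵒᵖ`, the category of proper degeneracy maps into the object `e`: maps
`e' ⟶ e` lying over a non-identity surjection `[n] ↠ [k]`, `k < n`, with their maps over `e`. -/
def properDegeneracy (p : E ⥤ SimplexCategoryᵒᵖ) (e : E) : ObjectProperty (Over e) := fun f =>
  Epi (p.map f.hom).unop ∧ (p.obj f.left).unop.len < (p.obj e).unop.len

/-- The diagram of the values of `F` at the sources of all proper degeneracy maps into `e`. -/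
def latchingDiagram (p : E ⥤ SimplexCategoryᵒᵖ) (F : E ⥤ A) (e : E) :
    (properDegeneracy p e).FullSubcategory ⥤ A :=
  (properDegeneracy p e).ι ⋙ Over.forget e ⋙ F

/-- The latching object of `F` at `e`: the colimit over all proper degeneracy maps into `e`. -/
noncomputable def latchingObj (p : E ⥤ SimplexCategoryᵒᵖ) (F : E ⥤ A) (e : E)
    [HasColimit (latchingDiagram p F e)] : A :=
  colimit (latchingDiagram p F e)

/-- The canonical cocone over the latching diagram, with vertex `F e`. -/
def latchingCocone (p : E ⥤ SimplexCategoryᵒᵖ) (F : E ⥤ A) (e : E) :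
    Cocone (latchingDiagram p F e) where
  pt := F.obj e
  ι :=
    { app := fun f => F.map f.obj.hom
      naturality := fun f g φ => by
        dsimp [latchingDiagram]
        rw [Category.comp_id, ← F.map_comp, Over.w] }

/-- The latching map from the latching object of `F` at `e` to `F e`. -/
noncomputable def latchingMap (p : E ⥤ SimplexCategoryᵒᵖ) (F : E ⥤ A) (e : E)
    [HasColimit (latchingDiagram p F e)] : latchingObj p F e ⟶ F.obj e :=
  colimit.desc _ (latchingCocone p F e)

/-- The canonical map into the latching object from the source of a proper degeneracy map. -/
noncomputable def latchingι (p : E ⥤ SimplexCategoryᵒᵖ) (F : E ⥤ A) (e : E)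
    [HasColimit (latchingDiagram p F e)] (f : Over e) (hf : properDegeneracy p e f) :
    F.obj f.left ⟶ latchingObj p F e :=
  colimit.ι (latchingDiagram p F e) ⟨f, hf⟩

lemma latchingι_comp_map (p : E ⥤ SimplexCategoryᵒᵖ) (F : E ⥤ A) (e : E)
    [HasColimit (latchingDiagram p F e)] (f : Over e) (hf : properDegeneracy p e f) :
    latchingι p F e f hf ≫ latchingMap p F e = F.map f.hom :=
  colimit.ι_desc (latchingCocone p F e) ⟨f, hf⟩

lemma latchingObj_hom_ext (p : E ⥤ SimplexCategoryᵒᵖ) (F : E ⥤ A) (e : E)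
    [HasColimit (latchingDiagram p F e)] {T : A} {g h : latchingObj p F e ⟶ T}
    (H : ∀ f hf, latchingι p F e f hf ≫ g = latchingι p F e f hf ≫ h) : g = h :=
  colimit.hom_ext fun f => H f.obj f.property

lemma map_comp_sigma_ι (S : SSet.{u}) [HasCoproducts.{u} A] (F : S.Elements ⥤ A)
    {m : SimplexCategoryᵒᵖ} {y y' : S.obj m} (h : y = y') {e : S.Elements}
    (φ : e ⟶ S.elementsMk m y) (ψ : e ⟶ S.elementsMk m y') (hv : φ.val = ψ.val) :
    F.map φ ≫ Limits.Sigma.ι (fun z : S.obj m => F.obj (S.elementsMk m z)) y =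
      F.map ψ ≫ Limits.Sigma.ι (fun z : S.obj m => F.obj (S.elementsMk m z)) y' := by
  subst h
  have h' : φ = ψ := CategoryOfElements.ext _ _ _ hv
  rw [h']

/-- Left Kan extension of a functor on the category of simplices `(Δᵒᵖ ↓ S)` of a simplicial set
`S` along the projection to `Δᵒᵖ` (a discrete opfibration): `n ↦ ∐_{x ∈ S_n} F(x)`. -/
noncomputable def fibrewiseCoproduct (S : SSet.{u}) [HasCoproducts.{u} A] (F : S.Elements ⥤ A) :
    SimplicialObject A where
  obj n := ∐ fun x : S.obj n => F.obj (S.elementsMk n x)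
  map {n m} f := Limits.Sigma.desc fun x =>
    F.map (CategoryOfElements.homMk (S.elementsMk n x) (S.elementsMk m (S.map f x)) f rfl) ≫
      Limits.Sigma.ι (fun y : S.obj m => F.obj (S.elementsMk m y)) (S.map f x)
  map_id n := by
    refine Limits.Sigma.hom_ext _ _ fun x => ?_
    rw [Limits.Sigma.ι_desc, Category.comp_id]
    have hx : S.map (𝟙 n) x = x := by simp
    rw [map_comp_sigma_ι S F hx _ (𝟙 (S.elementsMk n x)) rfl, F.map_id, Category.id_comp]
  map_comp {n m k} f g := by
    refine Limits.Sigma.hom_ext _ _ fun x => ?_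
    have hx : S.map (f ≫ g) x = S.map g (S.map f x) := by simp
    rw [Limits.Sigma.ι_desc, Limits.Sigma.ι_desc_assoc, Category.assoc, Limits.Sigma.ι_desc,
      ← Category.assoc, ← F.map_comp]
    exact map_comp_sigma_ι S F hx _ _ rfl

end General

section Normalized

open AlgebraicTopology DoldKan

variable {A : Type*} [Category A] [Abelian A] [HasColimits A] (B : SimplicialObject A)

/-- The latching map `L_n B ⟶ B_n` of a simplicial object, the inclusion of the degenerate
`n`-simplices. -/
noncomputable abbrev simplicialLatchingMap (n : ℕ) :
    latchingObj (𝟭 _) B (op (SimplexCategory.mk n)) ⟶ B.obj (op (SimplexCategory.mk n)) :=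
  latchingMap (𝟭 _) B (op (SimplexCategory.mk n))

lemma degeneraciesVanish_cokernel_π (n : ℕ) :
    DegeneraciesVanish (cokernel.π (simplicialLatchingMap B n)) := by
  cases n with
  | zero => trivial
  | succ n =>
    intro i
    have h := latchingι_comp_map (𝟭 SimplexCategoryᵒᵖ) B (op (SimplexCategory.mk (n + 1)))
      (Over.mk (SimplexCategory.σ i).op) ⟨by
        change Epi (SimplexCategory.σ i)
        infer_instance, Nat.lt_succ_self n⟩
    have h' : B.σ i = _ := h.symm
    rw [h']
    exact (Category.assoc _ _ _).trans (by rw [cokernel.condition, comp_zero])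

lemma latchingMap_comp_eq_zero {n : ℕ} {T : A} {g : B.obj (op (SimplexCategory.mk n)) ⟶ T}
    (hg : DegeneraciesVanish g) : simplicialLatchingMap B n ≫ g = 0 := by
  refine latchingObj_hom_ext _ _ _ fun f hf => ?_
  rw [comp_zero, ← Category.assoc, latchingι_comp_map]
  have hlt : f.left.unop.len < n := hf.2
  cases n with
  | zero => omega
  | succ n =>
    obtain ⟨i, θ, h⟩ := SimplexCategory.eq_σ_comp_of_not_injective f.hom.unop (fun hinj => by
      have hm : Mono f.hom.unop := SimplexCategory.mono_iff_injective.2 hinj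
      have := SimplexCategory.len_le_of_mono f.hom.unop
      change n + 1 ≤ _ at this
      change _ < n + 1 at hlt
      exact absurd hlt (not_lt.2 this))
    have h' : f.hom = θ.op ≫ (SimplexCategory.σ i).op := by
      rw [← op_comp, ← h]; rfl
    have h0 : B.map (SimplexCategory.σ i).op ≫ g = 0 := hg i
    rw [h', B.map_comp, Category.assoc, h0, comp_zero]

/-- The normalized boundary `B_{n+1} / L_{n+1} B ⟶ B_n / L_n B`, induced by the alternating sum of
the face maps. -/
noncomputable def normalizedD (n : ℕ) :
    cokernel (simplicialLatchingMap B (n + 1)) ⟶ cokernel (simplicialLatchingMap B n) :=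
  cokernel.desc _ (AlternatingFaceMapComplex.objD B n ≫ cokernel.π _) (by
    apply latchingMap_comp_eq_zero
    rw [degeneraciesVanish_iff_QInfty_f_comp]
    have h := (QInfty (X := B)).comm (n + 1) n
    have h0 := (degeneraciesVanish_iff_QInfty_f_comp _).1 (degeneraciesVanish_cokernel_π B n)
    have hd : (AlternatingFaceMapComplex.obj B).d (n + 1) n =
      AlternatingFaceMapComplex.objD B n := AlternatingFaceMapComplex.obj_d_eq B n
    rw [← hd]
    refine (Category.assoc _ _ _).symm.trans ?_
    rw [h]
    exact (Category.assoc _ _ _).trans (by rw [h0, comp_zero]))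

lemma cokernel_π_comp_normalizedD (n : ℕ) :
    cokernel.π (simplicialLatchingMap B (n + 1)) ≫ normalizedD B n =
      AlternatingFaceMapComplex.objD B n ≫ cokernel.π (simplicialLatchingMap B n) :=
  cokernel.π_desc _ _ _

/-- The normalized chain complex of a simplicial object, `(N B)_n = B_n / L_n B`, which is the
object of `Ch_A` that corresponds to `B` under the Dold-Kan equivalence. -/
noncomputable def normalizedComplex : ChainComplex A ℕ :=
  ChainComplex.of (fun n => cokernel (simplicialLatchingMap B n)) (normalizedD B) fun n => by
    rw [← cancel_epi (cokernel.π (simplicialLatchingMap B (n + 2))), ← Category.assoc,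
      cokernel_π_comp_normalizedD, Category.assoc, cokernel_π_comp_normalizedD, ← Category.assoc,
      AlternatingFaceMapComplex.d_squared, zero_comp, comp_zero]

end Normalized

/-! ### The magnitude nerve of a quasi-pseudo-metric space -/

section Nerve

/-- The functor `Σ` from `[0,∞)` (with a morphism `ℓ ⟶ m` exactly when `ℓ ≥ m`) to `ℝ`-graded
abelian groups: `Σ(ℓ)` is `ℤ` in grading `ℓ` and `0` in all other gradings. Since
`Hom(Σ(ℓ), Σ(m)) = 0` for `ℓ ≠ m`, non-identity morphisms are sent to `0`. -/
noncomputable def stabilization : ℝ≥0ᵒᵖ ⥤ GradedObject ℝ (ModuleCat.{u} ℤ) where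
  obj ℓ := fun k => open Classical in
    if (ℓ.unop : ℝ) = k then ModuleCat.of ℤ (ULift.{u} ℤ) else ModuleCat.of ℤ PUnit.{u + 1}
  map {ℓ m} _ := fun _ => open Classical in if h : ℓ = m then eqToHom (by rw [h]) else 0
  map_id ℓ := by
    funext k
    simp
  map_comp {a b c} f g := by
    funext k
    by_cases hab : a = b
    · subst hab
      by_cases hac : a = c
      · subst hac
        simp
      · simp [hac]
    · have hac : a ≠ c := fun hac => hab (by
        subst hac
        exact Opposite.unop_injective (le_antisymm g.unop.le f.unop.le))
      simp [hab, hac]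

variable (X : Type u)

/-- The nerve of the chaotic (indiscrete) groupoid on the set `X`: its `n`-simplices are the tuples
`(x_0, …, x_n)` of elements of `X`. -/
def chaoticNerve : SSet.{u} where
  obj n := Fin (n.unop.len + 1) → X
  map f := ↾ fun x => x ∘ f.unop.toOrderHom

variable {X} [QuasiPseudoMetric X]

/-- The total length `d(x_0,x_1) + ⋯ + d(x_{n-1},x_n)` of a tuple, i.e. the tensor product
`X(x_0,x_1) ⊗ ⋯ ⊗ X(x_{n-1},x_n) ⊗ 1` in `[0,∞)`. -/
noncomputable def length {n : ℕ} (x : Fin (n + 1) → X) : ℝ≥0 :=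
  ∑ i : Fin n, d (x i.castSucc) (x i.succ)

lemma d_le_sum_Ico (y : ℕ → X) {a b : ℕ} (h : a ≤ b) :
    d (y a) (y b) ≤ ∑ i ∈ Finset.Ico a b, d (y i) (y (i + 1)) := by
  induction b, h using Nat.le_induction with
  | base => simp [d_self]
  | succ b hab ih =>
    rw [Finset.sum_Ico_succ_top hab]
    exact (d_triangle _ (y b) _).trans (by gcongr)

lemma sum_le_sum_Ico (y : ℕ → X) (a : ℕ → ℕ) (ha : Monotone a) (m : ℕ) :
    ∑ i ∈ Finset.range m, d (y (a i)) (y (a (i + 1))) ≤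
      ∑ i ∈ Finset.Ico (a 0) (a m), d (y i) (y (i + 1)) := by
  induction m with
  | zero => simp
  | succ m ih =>
    rw [Finset.sum_range_succ, ← Finset.sum_Ico_consecutive _ (ha (Nat.zero_le m))
      (ha (Nat.le_succ m))]
    exact add_le_add ih (d_le_sum_Ico y (ha (Nat.le_succ m)))

/-- Composition of morphisms: lengths do not increase along a simplicial operator. -/
lemma length_comp_le {m n : ℕ} (x : Fin (n + 1) → X) (α : Fin (m + 1) →o Fin (n + 1)) :
    length (x ∘ α) ≤ length x := by
  let y : ℕ → X := fun i => x (Fin.ofNat (n + 1) (min i n))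
  let a : ℕ → ℕ := fun i => (α (Fin.ofNat (m + 1) (min i m)) : ℕ)
  have hmin : ∀ (k i : ℕ), (Fin.ofNat (k + 1) (min i k) : ℕ) = min i k := fun k i => by
    simp [Fin.ofNat]
  have ha : Monotone a := fun i j hij => by
    refine α.monotone (Fin.le_def.2 ?_)
    rw [hmin, hmin]
    omega
  have hy : ∀ i : Fin (n + 1), y i = x i := fun i => by
    change x _ = x i
    congr 1
    ext
    rw [hmin]
    omega
  have hα : ∀ (i : Fin (m + 1)), a i = α i := fun i => by
    change ((α _ : Fin (n + 1)) : ℕ) = α i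
    congr 2
    ext
    rw [hmin]
    omega
  have h1 : length (x ∘ α) = ∑ i ∈ Finset.range m, d (y (a i)) (y (a (i + 1))) := by
    rw [Finset.sum_range, length]
    refine Finset.sum_congr rfl fun i _ => ?_
    have e1 := hα i.castSucc
    have e2 := hα i.succ
    simp only [Fin.val_castSucc, Fin.val_succ] at e1 e2
    rw [e1, e2, hy, hy]
    rfl
  have h2 : length x = ∑ i ∈ Finset.range n, d (y i) (y (i + 1)) := by
    rw [Finset.sum_range, length]
    refine Finset.sum_congr rfl fun i _ => ?_
    have e1 := hy i.castSucc
    have e2 := hy i.succ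
    simp only [Fin.val_castSucc, Fin.val_succ] at e1 e2
    rw [e1, e2]
  rw [h1, h2]
  refine (sum_le_sum_Ico y a ha m).trans (Finset.sum_le_sum_of_subset fun i hi => ?_)
  have hm : a m ≤ n := Nat.lt_succ_iff.1 (α _).2
  rw [Finset.mem_Ico] at hi
  exact Finset.mem_range.2 (hi.2.trans_le hm)

variable (X)

/-- The length of a tuple, as a functor from the category of simplices `(Δᵒᵖ ↓ X_ch)` of the chaotic
nerve to `[0,∞)`. On inner faces it is the composition of `X`, on outer faces the unique map to the
unit object `0`, on degeneracies the identities of `X`. -/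
noncomputable def lengthFunctor : (chaoticNerve X).Elements ⥤ ℝ≥0ᵒᵖ where
  obj e := op (length (X := X) (n := e.1.unop.len) e.2)
  map {e e'} f := (homOfLE (by
    obtain ⟨f, hf⟩ := f
    rw [← hf]
    exact length_comp_le (X := X) (n := e.1.unop.len) (m := e'.1.unop.len) e.2
      f.unop.toOrderHom)).op

/-- The summands of the simplicial bar construction,
`B_{x_0,…,x_n}(ΣX, 𝟙) = ΣX(x_0,x_1) ⊗ ⋯ ⊗ ΣX(x_{n-1},x_n) ⊗ 𝟙(x_n,x_0)`
`= Σ(X(x_0,x_1) ⊗ ⋯ ⊗ X(x_{n-1},x_n) ⊗ 1)`,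
as a functor of the tuple `(x_0,…,x_n)`; here `⊗` of graded groups is convolution, for which `Σ` is
strong monoidal. -/
noncomputable def barSummand : (chaoticNerve X).Elements ⥤ GradedObject ℝ (ModuleCat.{u} ℤ) :=
  lengthFunctor X ⋙ stabilization

/-- The magnitude nerve `B_•(ΣX, 𝟙)`, a simplicial `ℝ`-graded abelian group, with
`B_n = ∐_{x_0,…,x_n} B_{x_0,…,x_n}(ΣX, 𝟙)`; it is written grading by grading. -/
noncomputable def magnitudeNerve : GradedObject ℝ (SimplicialObject (ModuleCat.{u} ℤ)) := fun ℓ =>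
  fibrewiseCoproduct (chaoticNerve X) (barSummand X ⋙ GradedObject.eval ℓ)

/-- The realized magnitude nerve `B(ΣX, 𝟙) = |B_•(ΣX, 𝟙)|`. For a simplicial object of an abelian
category, regarded as a simplicial object of (chain complexes concentrated in degree `0`), the
geometric realization is the object itself, that is, its normalized chain complex. -/
noncomputable def realizedMagnitudeNerve :
    GradedObject ℝ (ChainComplex (ModuleCat.{u} ℤ) ℕ) := fun ℓ =>
  normalizedComplex (magnitudeNerve X ℓ)

end Nerve

/-! ### The Hahn-series Euler characteristic -/

section Euler

/-- Finite complexes of abelian groups: those quasi-isomorphic to a bounded complex of finitely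
generated free abelian groups. A bounded complex of free groups is cofibrant, so that a single
quasi-isomorphism suffices. -/
def IsFiniteComplex (C : ChainComplex (ModuleCat.{u} ℤ) ℕ) : Prop :=
  ∃ (F : ChainComplex (ModuleCat.{u} ℤ) ℕ) (f : F ⟶ C),
    (∀ n, Module.Free ℤ (F.X n) ∧ Module.Finite ℤ (F.X n)) ∧
    (∃ N, ∀ n, N ≤ n → IsZero (F.X n)) ∧ QuasiIso f

/-- An `ℝ`-graded chain complex is Hahn finite if it is finite in every grading and if the support
of its graded Euler characteristic `ℓ ↦ ∑_n (-1)^n rk H_n(C_ℓ)` is well-ordered. -/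
structure IsHahnFinite (C : GradedObject ℝ (ChainComplex (ModuleCat.{u} ℤ) ℕ)) : Prop where
  finite : ∀ ℓ, IsFiniteComplex (C ℓ)
  wellOrdered : (Function.support fun ℓ => ((C ℓ).homologyEulerChar : ℚ)).IsPWO

/-- The Euler characteristic `χ` of Hahn finite graded chain complexes, with values in the field
`ℚ((q^ℝ))` of Hahn series. It is a partial function; the value is `0` outside its domain. -/
noncomputable def hahnEulerChar (C : GradedObject ℝ (ChainComplex (ModuleCat.{u} ℤ) ℕ)) :
    HahnSeries ℝ ℚ :=
  open Classical in
  if h : IsHahnFinite C then ⟨fun ℓ => ((C ℓ).homologyEulerChar : ℚ), h.wellOrdered⟩ else 0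

/-- A graded abelian group as a graded chain complex concentrated in degree `0`. -/
noncomputable def inDegreeZero (M : GradedObject ℝ (ModuleCat.{u} ℤ)) :
    GradedObject ℝ (ChainComplex (ModuleCat.{u} ℤ) ℕ) := fun ℓ =>
  (ChainComplex.single₀ (ModuleCat.{u} ℤ)).obj (M ℓ)

/-- The valuation topology on `ℚ((q^ℝ))`: the balls `{b | v(b - a) > r}` are a base. -/
instance hahnTopology : TopologicalSpace (HahnSeries ℝ ℚ) :=
  TopologicalSpace.generateFrom
    {U | ∃ (a : HahnSeries ℝ ℚ) (r : ℝ), U = {b | (r : WithTop ℝ) < HahnSeries.addVal ℝ ℚ (b - a)}}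

end Euler

/-! ### Weights and convergent magnitude Euler characteristic -/

section Weights

variable (X : Type u) [QuasiPseudoMetric X]

variable {X} in
/-- The tuple `(x_0,…,x_n)` as an object of the category of simplices of the chaotic nerve. -/
def tuple {n : ℕ} (x : Fin (n + 1) → X) : (chaoticNerve X).Elements :=
  (chaoticNerve X).elementsMk (op (SimplexCategory.mk n)) x

variable {X} in
/-- `B_{x_0,…,x_n}(ΣX, 𝟙)`, in degree `0`. -/
noncomputable def tupleObj {n : ℕ} (x : Fin (n + 1) → X) :
    GradedObject ℝ (ChainComplex (ModuleCat.{u} ℤ) ℕ) :=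
  inDegreeZero ((barSummand X).obj (tuple x))

variable {X} in
/-- `L_{x_0,…,x_n} B(ΣX, 𝟙)`, in degree `0`: the colimit, computed grading by grading, of the
summands in the sources of all proper degeneracy maps into the summand of `(x_0,…,x_n)`. -/
noncomputable def tupleLatching {n : ℕ} (x : Fin (n + 1) → X) :
    GradedObject ℝ (ChainComplex (ModuleCat.{u} ℤ) ℕ) :=
  inDegreeZero fun ℓ => latchingObj (CategoryOfElements.π (chaoticNerve X))
    (barSummand X ⋙ GradedObject.eval ℓ) (tuple x)

variable {X} in
/-- The weight `χ(B_{x_0,…,x_n}(ΣX, 𝟙)) - χ(L_{x_0,…,x_n} B(ΣX, 𝟙))` of a tuple. -/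
noncomputable def weight {n : ℕ} (x : Fin (n + 1) → X) : HahnSeries ℝ ℚ :=
  hahnEulerChar (tupleObj x) - hahnEulerChar (tupleLatching x)

/-- A finite quasi-pseudo-metric space has convergent magnitude Euler characteristic (with respect
to the Hahn-series Euler characteristic). The first two fields say that all weights are defined. -/
structure HasConvergentMagnitudeEulerChar [Fintype X] : Prop where
  finite_tupleObj : ∀ (n : ℕ) (x : Fin (n + 1) → X), IsHahnFinite (tupleObj x)
  finite_tupleLatching : ∀ (n : ℕ) (x : Fin (n + 1) → X), IsHahnFinite (tupleLatching x)
  finite_realizedNerve : IsHahnFinite (realizedMagnitudeNerve X)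
  converges : ∀ a b : X, ∃ s : HahnSeries ℝ ℚ, Tendsto
    (fun N : ℕ => ∑ n ∈ Finset.range N, (-1) ^ n *
      open Classical in
      ∑ x : Fin (n + 1) → X with x 0 = a ∧ x (Fin.last n) = b, weight x)
    atTop (𝓝 s)
  converges_to : Tendsto
    (fun N : ℕ => ∑ n ∈ Finset.range N, (-1) ^ n *
      open Classical in ∑ x : Fin (n + 1) → X, weight x)
    atTop (𝓝 (hahnEulerChar (realizedMagnitudeNerve X)))

end Weights

end MagnitudeHomology

/-!
At a degenerate tuple the category of proper degeneracies has a weakly initial object, given by the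
nondegenerate tuple underlying it, and all degeneracies preserve length; hence the latching map is
an isomorphism there. At a nondegenerate tuple that category is empty and the latching object is
`0`. So the weight of a tuple is `0` or `q ^ length`, respectively.

If `δ > 0` is the least distance between distinct points, a nondegenerate tuple `(x_0, …, x_n)` has
length at least `n δ`. This makes the series of weights summable, and in each grading it bounds the
normalized complex, whose `n`-chains are freely generated by the nondegenerate tuples of that
length. Invariance of the Euler characteristic of a bounded complex under passage to homology now
identifies the coefficients of the sum of the series with those of `χ (B(ΣX, 𝟙))`.
-/

namespace MagnitudeHomology

open QuasiPseudoMetric Simplicial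

section HahnSeries

variable {Γ R α : Type*}

lemma isPWO_iUnion_of_eventually_cofinite [LinearOrder Γ] {s : α → Set Γ} (hs : ∀ a, (s a).IsPWO)
    (h : ∀ r, ∀ᶠ a in cofinite, ∀ k ∈ s a, r < k) : (⋃ a, s a).IsPWO := by
  rw [Set.isPWO_iff_isWF, Set.isWF_iff_no_descending_seq]
  intro f hf hmem
  have hF : {a | ¬ ∀ k ∈ s a, f 0 < k}.Finite := h (f 0)
  have hPWO : (⋃ a ∈ hF.toFinset, s a).IsPWO := (Finset.isPWO_bUnion _).2 fun a _ => hs a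
  refine Set.isWF_iff_no_descending_seq.1 hPWO.isWF f hf fun n => ?_
  obtain ⟨a, ha⟩ := Set.mem_iUnion.1 (hmem n)
  have haF : a ∈ hF.toFinset := hF.mem_toFinset.2 fun hlt =>
    (hlt _ ha).not_ge (hf.antitone (Nat.zero_le n))
  exact Set.mem_biUnion haF ha

lemma lt_orderTop_iff_forall [LinearOrder Γ] [Zero R] {s : HahnSeries Γ R} {r : Γ} :
    (r : WithTop Γ) < s.orderTop ↔ ∀ k ≤ r, s.coeff k = 0 := by
  refine ⟨fun h k hk => HahnSeries.coeff_eq_zero_of_lt_orderTop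
    ((WithTop.coe_le_coe.2 hk).trans_lt h), fun h => lt_of_not_ge fun hle => ?_⟩
  obtain ⟨k, hk, -⟩ := WithTop.le_coe_iff.1 hle
  exact HahnSeries.coeff_orderTop_ne hk (h k (WithTop.coe_le_coe.1 (hk ▸ hle)))

/-- A family of Hahn series whose orders tend to infinity, as a summable family. -/
def summableFamilyOfOrderTop [LinearOrder Γ] [AddCommMonoid R] (f : α → HahnSeries Γ R)
    (h : ∀ r : Γ, ∀ᶠ a in cofinite, (r : WithTop Γ) < (f a).orderTop) :
    HahnSeries.SummableFamily Γ R α where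
  toFun := f
  isPWO_iUnion_support' := isPWO_iUnion_of_eventually_cofinite (fun a => (f a).isPWO_support)
    fun r => (h r).mono fun _ ha k hk => lt_of_not_ge fun hle =>
      hk (lt_orderTop_iff_forall.1 ha k hle)
  finite_co_support' r := (h r).mono fun _ => HahnSeries.coeff_eq_zero_of_lt_orderTop

lemma tendsto_nhds_hahnSeries {l : Filter α} {f : α → HahnSeries ℝ ℚ} {s : HahnSeries ℝ ℚ}
    (h : ∀ r : ℝ, ∀ᶠ a in l, (r : WithTop ℝ) < (f a - s).orderTop) : Tendsto f l (𝓝 s) := by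
  refine TopologicalSpace.tendsto_nhds_generateFrom_iff.2 ?_
  rintro _ ⟨a, r, rfl⟩ hs
  filter_upwards [h r] with i hi
  rw [Set.mem_preimage, Set.mem_ofPred, ← sub_add_sub_cancel _ s a]
  exact (lt_min hi hs).trans_le HahnSeries.min_orderTop_le_orderTop_add

lemma hasSum_hsum {s : HahnSeries.SummableFamily ℝ ℚ α}
    (h : ∀ r : ℝ, ∀ᶠ a in cofinite, (r : WithTop ℝ) < (s a).orderTop) : HasSum s s.hsum := by
  refine tendsto_nhds_hahnSeries fun r => ?_
  have hF : {a | ¬ (r : WithTop ℝ) < (s a).orderTop}.Finite := h r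
  filter_upwards [eventually_ge_atTop hF.toFinset] with T hT
  refine lt_orderTop_iff_forall.2 fun k hk => ?_
  have hsupp : {a | (s a).coeff k ≠ 0} ⊆ T := fun a ha =>
    hT (hF.mem_toFinset.2 fun hlt => ha (lt_orderTop_iff_forall.1 hlt k hk))
  rw [HahnSeries.coeff_sub, HahnSeries.coeff_sum,
    HahnSeries.SummableFamily.coeff_hsum_eq_sum_of_subset hsupp, sub_self]

lemma orderTop_neg_one_pow_mul [AddCommMonoid Γ] [PartialOrder Γ] [IsOrderedCancelAddMonoid Γ]
    [Ring R] (n : ℕ) (s : HahnSeries Γ R) :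
    ((-1) ^ n * s).orderTop = s.orderTop := by
  rcases n.even_or_odd with h | h <;> simp [h.neg_one_pow]

lemma coeff_neg_one_pow_mul [AddCommMonoid Γ] [PartialOrder Γ] [IsOrderedCancelAddMonoid Γ]
    [Ring R] (n : ℕ) (s : HahnSeries Γ R) (ℓ : Γ) :
    ((-1) ^ n * s).coeff ℓ = (-1) ^ n * s.coeff ℓ := by
  rcases n.even_or_odd with h | h <;> simp [h.neg_one_pow]

end HahnSeries

section EulerPoincare

variable {R : Type*} [Ring R] [StrongRankCondition R] [HasRankNullity.{u} R] [IsNoetherianRing R]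

lemma finrank_homology_add (S : ShortComplex (ModuleCat.{u} R)) [Module.Finite R S.X₂] :
    Module.finrank R S.homology + Module.finrank R (LinearMap.range S.f.hom) +
      Module.finrank R (LinearMap.range S.g.hom) = Module.finrank R S.X₂ := by
  have h_homology : Module.finrank R S.homology =
      Module.finrank R (LinearMap.ker S.g.hom ⧸ LinearMap.range S.moduleCatToCycles) :=
    S.moduleCatHomologyIso.toLinearEquiv.finrank_eq
  have h_boundaries : Module.finrank R (LinearMap.range S.moduleCatToCycles) =
      Module.finrank R (LinearMap.range S.f.hom) := by
    have h : S.f.hom = (LinearMap.ker S.g.hom).subtype ∘ₗ S.moduleCatToCycles := rfl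
    rw [h, LinearMap.range_comp]
    exact (Submodule.equivMapOfInjective _ (Submodule.injective_subtype _) _).finrank_eq
  have h_cycles := Submodule.finrank_quotient_add_finrank (LinearMap.range S.moduleCatToCycles)
  have h_rank_nullity := Submodule.finrank_quotient_add_finrank (LinearMap.ker S.g.hom)
  rw [S.g.hom.quotKerEquivRange.finrank_eq] at h_rank_nullity
  omega

variable {ι : Type*} {c : ComplexShape ι} [c.EulerCharSigns]

lemma sum_χ_mul_prev_eq_neg_sum_χ_mul_next {ρ : ι → ι → ℤ} (hρ : ∀ i j, ρ i j ≠ 0 → c.Rel i j)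
    {s : Finset ι} (hs_prev : ∀ i ∉ s, ρ (c.prev i) i = 0) (hs_next : ∀ i ∉ s, ρ i (c.next i) = 0) :
    ∑ i ∈ s, (c.χ i : ℤ) * ρ (c.prev i) i = -∑ i ∈ s, (c.χ i : ℤ) * ρ i (c.next i) := by
  have rel_prev {i : ι} (h : (c.χ i : ℤ) * ρ (c.prev i) i ≠ 0) : c.Rel (c.prev i) i :=
    hρ _ _ (right_ne_zero_of_mul h)
  have rel_next {i : ι} (h : -((c.χ i : ℤ) * ρ i (c.next i)) ≠ 0) : c.Rel i (c.next i) :=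
    hρ _ _ (right_ne_zero_of_mul (neg_ne_zero.1 h))
  rw [← Finset.sum_neg_distrib]
  refine Finset.sum_bij_ne_zero (fun i _ _ => c.prev i) (fun i _ h => ?_)
    (fun i _ hi j _ hj hij => c.next_eq (rel_prev hi) (hij ▸ rel_prev hj))
    (fun j _ h => ⟨c.next j, ?_, ?_, c.prev_eq' (rel_next h)⟩) (fun i _ h => ?_)
  · refine by_contra fun hp => right_ne_zero_of_mul h ?_
    simpa only [c.next_eq' (rel_prev h)] using hs_next _ hp
  · refine by_contra fun hn => right_ne_zero_of_mul (neg_ne_zero.1 h) ?_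
    simpa only [c.prev_eq' (rel_next h)] using hs_prev _ hn
  · rw [c.prev_eq' (rel_next h), c.χ_next (rel_next h), Units.val_neg, neg_mul]
    exact h
  · rw [c.next_eq' (rel_prev h), c.χ_next (rel_prev h), Units.val_neg, neg_mul]

lemma homologyEulerChar_eq_eulerChar (C : HomologicalComplex (ModuleCat.{u} R) c)
    [∀ i, Module.Finite R (C.X i)] (hC : (GradedObject.finrankSupport C.X).Finite) :
    C.homologyEulerChar = C.eulerChar := by
  have h_rank (i : ι) : Module.finrank R (C.homology i) +
      Module.finrank R (LinearMap.range (C.d (c.prev i) i).hom) +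
      Module.finrank R (LinearMap.range (C.d i (c.next i)).hom) = Module.finrank R (C.X i) := by
    have : Module.Finite R (C.sc i).X₂ := inferInstanceAs (Module.Finite R (C.X i))
    exact finrank_homology_add (C.sc i)
  have h_vanish (i : ι) (hi : i ∉ hC.toFinset) : Module.finrank R (C.homology i) = 0 ∧
      Module.finrank R (LinearMap.range (C.d (c.prev i) i).hom) = 0 ∧
      Module.finrank R (LinearMap.range (C.d i (c.next i)).hom) = 0 := by
    have := h_rank i
    have := (GradedObject.finrankSupport_subset_iff C.X _).1 hC.coe_toFinset.ge i hi
    omega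
  have := nontrivial_of_invariantBasisNumber R
  have h_boundaries := sum_χ_mul_prev_eq_neg_sum_χ_mul_next (c := c) (s := hC.toFinset)
    (ρ := fun i j => Module.finrank R (LinearMap.range (C.d i j).hom))
    (fun i j h => by_contra fun hij => h (by
      rw [C.shape i j hij, ModuleCat.hom_zero, LinearMap.range_zero, finrank_bot, Nat.cast_zero]))
    (fun i hi => by exact_mod_cast (h_vanish i hi).2.1)
    (fun i hi => by exact_mod_cast (h_vanish i hi).2.2)
  have h_homology : GradedObject.finrankSupport (fun i => C.homology i) ⊆ hC.toFinset :=
    (GradedObject.finrankSupport_subset_iff _ _).2 fun i hi => (h_vanish i hi).1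
  rw [C.homologyEulerChar_eq_sum_finSet_of_finrankSupport_subset _ h_homology,
    C.eulerChar_eq_sum_finSet_of_finrankSupport_subset hC.toFinset hC.coe_toFinset.ge]
  simp only [← h_rank, Nat.cast_add, mul_add, Finset.sum_add_distrib, h_boundaries]
  ring

end EulerPoincare

section HahnEulerChar

/-- The graded complex `C` is Hahn finite with Euler characteristic `s`. This relational form of
`IsHahnFinite` and `hahnEulerChar` never mentions the junk value of the latter. -/
structure HasHahnEulerChar (C : GradedObject ℝ (ChainComplex (ModuleCat.{u} ℤ) ℕ))
    (s : HahnSeries ℝ ℚ) : Prop where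
  isFiniteComplex : ∀ ℓ, IsFiniteComplex (C ℓ)
  homologyEulerChar_eq_coeff : ∀ ℓ, ((C ℓ).homologyEulerChar : ℚ) = s.coeff ℓ

variable {C : GradedObject ℝ (ChainComplex (ModuleCat.{u} ℤ) ℕ)}

lemma HasHahnEulerChar.isHahnFinite {s : HahnSeries ℝ ℚ} (h : HasHahnEulerChar C s) :
    IsHahnFinite C :=
  ⟨h.isFiniteComplex, by simpa only [h.homologyEulerChar_eq_coeff] using s.isPWO_support'⟩

lemma HasHahnEulerChar.hahnEulerChar_eq {s : HahnSeries ℝ ℚ} (h : HasHahnEulerChar C s) :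
    hahnEulerChar C = s := by
  rw [hahnEulerChar, dif_pos h.isHahnFinite]
  ext ℓ
  exact h.homologyEulerChar_eq_coeff ℓ

lemma isFiniteComplex_of_free (K : ChainComplex (ModuleCat.{u} ℤ) ℕ) [∀ n, Module.Free ℤ (K.X n)]
    [∀ n, Module.Finite ℤ (K.X n)] (hK : (GradedObject.finrankSupport K.X).Finite) :
    IsFiniteComplex K := by
  obtain ⟨N, hN⟩ := hK.bddAbove
  refine ⟨K, 𝟙 K, fun n => ⟨inferInstance, inferInstance⟩, ⟨N + 1, fun n hn => ?_⟩, inferInstance⟩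
  have hrank : Module.finrank ℤ (K.X n) = 0 := by_contra fun h => (hN h).not_gt hn
  have := (Module.finrank_eq_zero_iff_of_free ℤ (K.X n)).1 hrank
  exact ModuleCat.isZero_of_subsingleton _

lemma hasHahnEulerChar_hsum [∀ ℓ n, Module.Free ℤ ((C ℓ).X n)]
    [∀ ℓ n, Module.Finite ℤ ((C ℓ).X n)] {s : HahnSeries.SummableFamily ℝ ℚ ℕ}
    (hs : ∀ n ℓ, (s n).coeff ℓ = (-1) ^ n * Module.finrank ℤ ((C ℓ).X n)) :
    HasHahnEulerChar C s.hsum := by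
  have hfin (ℓ : ℝ) : (GradedObject.finrankSupport (C ℓ).X).Finite :=
    (s.finite_co_support ℓ).subset fun n hn => by simpa [hs, GradedObject.finrankSupport] using hn
  refine ⟨fun ℓ => isFiniteComplex_of_free (C ℓ) (hfin ℓ), fun ℓ => ?_⟩
  rw [homologyEulerChar_eq_eulerChar (C ℓ) (hfin ℓ), HahnSeries.SummableFamily.coeff_hsum]
  refine ((Int.castAddHom ℚ).map_finsum_of_injective Int.cast_injective _).trans
    (finsum_congr fun n => ?_)
  simp [hs]

lemma hasHahnEulerChar_inDegreeZero {M : GradedObject ℝ (ModuleCat.{u} ℤ)}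
    [∀ ℓ, Module.Free ℤ (M ℓ)] [∀ ℓ, Module.Finite ℤ (M ℓ)] {s : HahnSeries ℝ ℚ}
    (hs : ∀ ℓ, s.coeff ℓ = Module.finrank ℤ (M ℓ)) : HasHahnEulerChar (inDegreeZero M) s := by
  have hzero (ℓ : ℝ) (n : ℕ) : Subsingleton ((inDegreeZero M ℓ).X (n + 1)) :=
    ModuleCat.subsingleton_of_isZero (HomologicalComplex.isZero_single_obj_X _ _ _ _ (by simp))
  have hfree (ℓ : ℝ) (n : ℕ) : Module.Free ℤ ((inDegreeZero M ℓ).X n) := match n with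
    | 0 => inferInstanceAs (Module.Free ℤ (M ℓ))
    | _ + 1 => inferInstance
  have hfin (ℓ : ℝ) (n : ℕ) : Module.Finite ℤ ((inDegreeZero M ℓ).X n) := match n with
    | 0 => inferInstanceAs (Module.Finite ℤ (M ℓ))
    | _ + 1 => inferInstance
  rw [← HahnSeries.SummableFamily.hsum_single 0 s]
  refine hasHahnEulerChar_hsum fun n ℓ => ?_
  cases n with
  | zero =>
    rw [HahnSeries.SummableFamily.single_toFun, Pi.single_eq_same, pow_zero, one_mul]
    exact hs ℓ
  | succ n => simp [Module.finrank_zero_of_subsingleton]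

end HahnEulerChar

section EilenbergZilber

variable {S : SSet.{u}} {n : ℕ}

lemma exists_lt_epi_nonDegenerate_of_mem_degenerate {x : S _⦋n⦌} (hx : x ∈ S.degenerate n) :
    ∃ m < n, ∃ s : ⦋n⦌ ⟶ ⦋m⦌, Epi s ∧ ∃ y ∈ S.nonDegenerate m, S.map s.op y = x := by
  obtain ⟨k, hk, t, ht, z, rfl⟩ := (S.mem_degenerate_iff x).1 hx
  obtain ⟨m, r, hr, y, rfl⟩ := S.exists_nonDegenerate z
  exact ⟨m, (SimplexCategory.len_le_of_epi r).trans_lt hk, t ≫ r, epi_comp t r, y.1, y.2, by simp⟩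

lemma exists_epi_of_map_op_eq {m k : ℕ} {s : ⦋n⦌ ⟶ ⦋m⦌} {t : ⦋n⦌ ⟶ ⦋k⦌} [Epi s] [Epi t]
    {y : S _⦋m⦌} (hy : y ∈ S.nonDegenerate m) {z : S _⦋k⦌} (h : S.map s.op y = S.map t.op z) :
    ∃ r : ⦋k⦌ ⟶ ⦋m⦌, Epi r ∧ t ≫ r = s ∧ S.map r.op y = z := by
  obtain ⟨l, r, hr, w, rfl⟩ := S.exists_nonDegenerate z
  have h' : S.map s.op y = S.map (t ≫ r).op w := h.trans (by simp)
  have : Epi (t ≫ r) := epi_comp _ _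
  obtain rfl := S.unique_nonDegenerate_dim _ s ⟨y, hy⟩ rfl _ w h'
  obtain rfl := S.unique_nonDegenerate_simplex _ s ⟨y, hy⟩ rfl _ w h'
  exact ⟨r, hr, (S.unique_nonDegenerate_map _ s ⟨y, hy⟩ rfl _ ⟨y, hy⟩ h').symm, rfl⟩

end EilenbergZilber

section Latching

variable {A : Type*} [Category A] {S : SSet.{u}} {F : S.Elements ⥤ A}

variable (S F) in
/-- The functor `F` inverts all morphisms of the category of simplices that lie over surjections. -/
def InvertsDegeneracies : Prop :=
  ∀ ⦃e e' : S.Elements⦄ (φ : e ⟶ e'), Epi φ.val.unop → IsIso (F.map φ)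

lemma InvertsDegeneracies.comp {A' : Type*} [Category A'] (hF : InvertsDegeneracies S F)
    (G : A ⥤ A') : InvertsDegeneracies S (F ⋙ G) := fun _ _ φ hφ =>
  have := hF φ hφ
  inferInstanceAs (IsIso (G.map (F.map φ)))

variable {n : ℕ} {x : S _⦋n⦌}

lemma isEmpty_properDegeneracy (hx : x ∈ S.nonDegenerate n) :
    IsEmpty (properDegeneracy (CategoryOfElements.π S)
      (S.elementsMk (op ⦋n⦌) x)).FullSubcategory :=
  ⟨fun f => hx ⟨f.obj.left.1.unop.len, f.property.2, f.obj.hom.val.unop, f.obj.left.2,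
    f.obj.hom.property⟩⟩

/-- The latching object at a nondegenerate simplex is initial. -/
noncomputable def latchingObjIsInitial (hx : x ∈ S.nonDegenerate n)
    [HasColimit (latchingDiagram (CategoryOfElements.π S) F (S.elementsMk (op ⦋n⦌) x))] :
    IsInitial (latchingObj (CategoryOfElements.π S) F (S.elementsMk (op ⦋n⦌) x)) :=
  have := isEmpty_properDegeneracy hx
  IsInitial.ofUniqueHom (fun T => colimit.desc _
    ⟨T, ⟨fun f => isEmptyElim f, fun f => isEmptyElim f⟩⟩)
    fun _ _ => colimit.hom_ext fun f => isEmptyElim f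

lemma exists_weaklyInitial_properDegeneracy (hx : x ∈ S.degenerate n) :
    ∃ f : Over (S.elementsMk (op ⦋n⦌) x), properDegeneracy (CategoryOfElements.π S) _ f ∧
      ∀ g, properDegeneracy (CategoryOfElements.π S) _ g →
        ∃ φ : f ⟶ g, Epi φ.left.val.unop := by
  obtain ⟨m, hm, s, hs, y, hy, rfl⟩ := exists_lt_epi_nonDegenerate_of_mem_degenerate hx
  refine ⟨Over.mk (Y := S.elementsMk (op ⦋m⦌) y) (CategoryOfElements.homMk _ _ s.op rfl),
    ⟨hs, hm⟩, fun g hg => ?_⟩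
  have : Epi g.hom.val.unop := hg.1
  obtain ⟨r, hr, hrs, hry⟩ := exists_epi_of_map_op_eq (t := g.hom.val.unop) (z := g.left.2) hy
    g.hom.property.symm
  exact ⟨Over.homMk (CategoryOfElements.homMk _ _ r.op hry)
    (CategoryOfElements.ext _ _ _ (congrArg Quiver.Hom.op hrs)), hr⟩

lemma isIso_latchingMap (hF : InvertsDegeneracies S F) (hx : x ∈ S.degenerate n)
    [HasColimit (latchingDiagram (CategoryOfElements.π S) F (S.elementsMk (op ⦋n⦌) x))] :
    IsIso (latchingMap (CategoryOfElements.π S) F (S.elementsMk (op ⦋n⦌) x)) := by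
  obtain ⟨f, hfp, hf⟩ := exists_weaklyInitial_properDegeneracy hx
  have := hF f.hom hfp.1
  refine ⟨inv (F.map f.hom) ≫ latchingι _ F _ f hfp, ?_, ?_⟩
  · refine latchingObj_hom_ext _ _ _ fun g hg => ?_
    obtain ⟨φ, hφ⟩ := hf g hg
    have := hF φ.left hφ
    have h_cocone : F.map φ.left ≫ latchingι _ F _ g hg = latchingι _ F _ f hfp :=
      colimit.w (latchingDiagram (CategoryOfElements.π S) F (S.elementsMk (op ⦋n⦌) x))
        (j' := ⟨f, hfp⟩) (j := ⟨g, hg⟩) ⟨φ⟩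
    rw [Category.comp_id, ← Category.assoc, latchingι_comp_map, ← cancel_epi (F.map φ.left),
      h_cocone, ← Category.assoc, ← F.map_comp, Over.w, IsIso.hom_inv_id_assoc]
  · rw [Category.assoc, latchingι_comp_map, IsIso.inv_hom_id]

end Latching

section Normalized

variable {A : Type*} [Category A]

lemma simplicialLatchingMap_comp_eq_zero_iff [Abelian A] [HasColimits A] {B : SimplicialObject A}
    {n : ℕ} {T : A} {g : B.obj (op ⦋n⦌) ⟶ T} : simplicialLatchingMap B n ≫ g = 0 ↔
      ∀ m < n, ∀ t : ⦋n⦌ ⟶ ⦋m⦌, Epi t → B.map t.op ≫ g = 0 := by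
  refine ⟨fun h m hm t ht => ?_, fun h => latchingObj_hom_ext _ _ _ fun f hf => ?_⟩
  · have ht' := latchingι_comp_map (𝟭 SimplexCategoryᵒᵖ) B (op ⦋n⦌) (Over.mk t.op) ⟨ht, hm⟩
    exact (congrArg (· ≫ g) ht').symm.trans ((Category.assoc _ _ _).trans (by rw [h, comp_zero]))
  · rw [comp_zero, ← Category.assoc, latchingι_comp_map]
    exact h _ hf.2 f.hom.unop hf.1

variable {S : SSet.{u}} [HasCoproducts.{u} A] (F : S.Elements ⥤ A)

/-- The inclusion of the summand of a simplex into a fibrewise coproduct. -/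
noncomputable abbrev fibrewiseι {n : ℕ} (x : S _⦋n⦌) :
    F.obj (S.elementsMk (op ⦋n⦌) x) ⟶ (fibrewiseCoproduct S F).obj (op ⦋n⦌) :=
  Limits.Sigma.ι (fun z : S _⦋n⦌ => F.obj (S.elementsMk (op ⦋n⦌) z)) x

variable {F} in
lemma fibrewise_hom_ext {n : ℕ} {T : A} {g h : (fibrewiseCoproduct S F).obj (op ⦋n⦌) ⟶ T}
    (H : ∀ x : S _⦋n⦌, fibrewiseι F x ≫ g = fibrewiseι F x ≫ h) : g = h :=
  Limits.Sigma.hom_ext _ _ H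

lemma fibrewiseι_comp_map {n m : ℕ} (f : ⦋m⦌ ⟶ ⦋n⦌) (x : S _⦋n⦌) :
    fibrewiseι F x ≫ (fibrewiseCoproduct S F).map f.op =
      F.map (CategoryOfElements.homMk (S.elementsMk _ x) (S.elementsMk _ (S.map f.op x)) f.op rfl) ≫
        fibrewiseι F (S.map f.op x) :=
  Limits.Sigma.ι_desc _ _

variable {F} in
lemma fibrewise_latchingMap_comp_eq_zero_iff [Abelian A] [HasColimits A]
    (hF : InvertsDegeneracies S F) {n : ℕ} {T : A}
    {g : (fibrewiseCoproduct S F).obj (op ⦋n⦌) ⟶ T} :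
    simplicialLatchingMap (fibrewiseCoproduct S F) n ≫ g = 0 ↔
      ∀ x ∈ S.degenerate n, fibrewiseι F x ≫ g = 0 := by
  rw [simplicialLatchingMap_comp_eq_zero_iff]
  refine ⟨fun h x hx => ?_, fun h m hm t ht => fibrewise_hom_ext fun z => ?_⟩
  · obtain ⟨m, hm, t, ht, z, rfl⟩ := (S.mem_degenerate_iff x).1 hx
    let φ := CategoryOfElements.homMk (S.elementsMk _ z) (S.elementsMk _ (S.map t.op z)) t.op rfl
    have : IsIso (F.map φ) := hF φ ht
    rw [← cancel_epi (F.map φ), ← Category.assoc, ← fibrewiseι_comp_map, Category.assoc,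
      h m hm t ht, comp_zero, comp_zero]
  · rw [← Category.assoc, fibrewiseι_comp_map, Category.assoc,
      h _ ((S.mem_degenerate_iff _).2 ⟨m, hm, t, ht, z, rfl⟩), comp_zero, comp_zero]

/-- The coproduct of the values of `F` at the nondegenerate `n`-simplices. -/
noncomputable abbrev nonDegenerateCoproduct (n : ℕ) : A :=
  ∐ fun x : S.nonDegenerate n => F.obj (S.elementsMk (op ⦋n⦌) x.1)

open Classical in
/-- The projection of `∐_{x ∈ S_n} F(x)` onto the summands of the nondegenerate simplices. -/
noncomputable def toNonDegenerate [HasZeroMorphisms A] (n : ℕ) :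
    (fibrewiseCoproduct S F).obj (op ⦋n⦌) ⟶ nonDegenerateCoproduct F n :=
  Limits.Sigma.desc fun x => if h : x ∈ S.nonDegenerate n then
    Limits.Sigma.ι (fun x : S.nonDegenerate n => F.obj (S.elementsMk (op ⦋n⦌) x.1)) ⟨x, h⟩ else 0

lemma fibrewiseι_toNonDegenerate [HasZeroMorphisms A] {n : ℕ} (x : S.nonDegenerate n) :
    fibrewiseι F x.1 ≫ toNonDegenerate F n =
      Limits.Sigma.ι (fun x : S.nonDegenerate n => F.obj (S.elementsMk (op ⦋n⦌) x.1)) x :=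
  (Limits.Sigma.ι_desc _ _).trans (dif_pos x.2)

lemma fibrewiseι_toNonDegenerate_eq_zero [HasZeroMorphisms A] {n : ℕ} {x : S _⦋n⦌}
    (hx : x ∈ S.degenerate n) : fibrewiseι F x ≫ toNonDegenerate F n = 0 :=
  (Limits.Sigma.ι_desc _ _).trans (dif_neg fun h => h hx)

variable {F} in
/-- The quotient of the fibrewise coproduct by its degenerate part is the coproduct over the
nondegenerate simplices. -/
noncomputable def cokernelLatchingIso [Abelian A] [HasColimits A] (hF : InvertsDegeneracies S F)
    (n : ℕ) :
    cokernel (simplicialLatchingMap (fibrewiseCoproduct S F) n) ≅ nonDegenerateCoproduct F n where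
  hom := cokernel.desc _ (toNonDegenerate F n) <|
    (fibrewise_latchingMap_comp_eq_zero_iff hF).2 fun _ => fibrewiseι_toNonDegenerate_eq_zero F
  inv := Limits.Sigma.desc fun x => fibrewiseι F x.1 ≫ cokernel.π _
  hom_inv_id := by
    rw [← cancel_epi (cokernel.π _), cokernel.π_desc_assoc, Category.comp_id]
    refine fibrewise_hom_ext fun x => ?_
    rw [← Category.assoc]
    by_cases hx : x ∈ S.degenerate n
    · rw [fibrewiseι_toNonDegenerate_eq_zero F hx, zero_comp,
        (fibrewise_latchingMap_comp_eq_zero_iff hF).1 (cokernel.condition _) x hx]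
    · rw [fibrewiseι_toNonDegenerate F ⟨x, hx⟩]
      exact Limits.Sigma.ι_desc _ _
  inv_hom_id := by
    refine Limits.Sigma.hom_ext _ _ fun x => ?_
    rw [Limits.Sigma.ι_desc_assoc, Category.assoc, cokernel.π_desc, fibrewiseι_toNonDegenerate,
      Category.comp_id]

end Normalized

section Lengths

variable {X : Type u}

lemma ne_succ_of_mem_nonDegenerate {n : ℕ} {x : Fin (n + 1) → X}
    (hx : x ∈ (chaoticNerve X).nonDegenerate n) (i : Fin n) : x i.castSucc ≠ x i.succ := by
  intro h
  cases n with
  | zero => exact i.elim0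
  | succ n =>
    refine hx ⟨n, Nat.lt_succ_self n, SimplexCategory.σ i, x ∘ i.castSucc.succAbove, ?_⟩
    funext j
    change x (i.castSucc.succAbove (i.predAbove j)) = x j
    by_cases hj : j = i.castSucc
    · rw [hj, Fin.predAbove_castSucc_self, Fin.succAbove_castSucc_self, h]
    · rw [Fin.succAbove_predAbove hj]

variable [QuasiPseudoMetric X]

lemma length_comp_of_leftInverse {m n : ℕ} (x : Fin (n + 1) → X)
    {α : Fin (m + 1) →o Fin (n + 1)} {β : Fin (n + 1) →o Fin (m + 1)}
    (h : Function.LeftInverse α β) : length (x ∘ α) = length x :=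
  (length_comp_le x α).antisymm <| by
    simpa only [Function.comp_assoc, h.comp_eq_id, Function.comp_id]
      using length_comp_le (x ∘ α) β

lemma length_eq_of_epi {e e' : (chaoticNerve X).Elements} (φ : e ⟶ e') (h : Epi φ.val.unop) :
    length (X := X) (n := e.1.unop.len) e.2 = length (X := X) (n := e'.1.unop.len) e'.2 := by
  obtain ⟨⟨s⟩⟩ := isSplitEpi_of_epi φ.val.unop
  rw [← φ.property]
  exact (length_comp_of_leftInverse (X := X) e.2 (β := s.section_.toOrderHom)
    (SimplexCategory.congr_toOrderHom_apply s.id)).symm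

lemma invertsDegeneracies_lengthFunctor :
    InvertsDegeneracies (chaoticNerve X) (lengthFunctor X) := by
  intro e e' φ h
  have hl : (lengthFunctor X).obj e = (lengthFunctor X).obj e' :=
    congrArg op (length_eq_of_epi φ h)
  rw [Subsingleton.elim ((lengthFunctor X).map φ) (eqToHom hl)]
  infer_instance

lemma invertsDegeneracies_barSummand (ℓ : ℝ) :
    InvertsDegeneracies (chaoticNerve X) (barSummand X ⋙ GradedObject.eval ℓ) :=
  invertsDegeneracies_lengthFunctor.comp (stabilization ⋙ GradedObject.eval ℓ)

lemma exists_pos_le_d [Finite X] (hX : IsQuasiMetric X) :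
    ∃ δ : ℝ≥0, 0 < δ ∧ ∀ x y : X, x ≠ y → δ ≤ d x y := by
  have h : ∀ᶠ δ in 𝓝[>] (0 : ℝ≥0), ∀ p : X × X, p.1 ≠ p.2 → δ ≤ d p.1 p.2 := by
    refine eventually_all.2 fun p => eventually_imp_distrib_left.2 fun hp => ?_
    filter_upwards [mem_nhdsWithin_of_mem_nhds (Iio_mem_nhds (hX _ _ hp))] with δ hδ
    exact le_of_lt hδ
  obtain ⟨δ, hδ, hpos⟩ := (h.and self_mem_nhdsWithin).exists
  exact ⟨δ, hpos, fun x y => hδ (x, y)⟩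

lemma nsmul_le_length {δ : ℝ≥0} (hδ : ∀ x y : X, x ≠ y → δ ≤ d x y) {n : ℕ} {x : Fin (n + 1) → X}
    (hx : x ∈ (chaoticNerve X).nonDegenerate n) : n • δ ≤ length x := by
  simpa only [length, Finset.card_univ, Fintype.card_fin] using
    Finset.card_nsmul_le_sum Finset.univ _ δ fun i _ =>
      hδ _ _ (ne_succ_of_mem_nonDegenerate hx i)

lemma eventually_lt_length [Finite X] (hX : IsQuasiMetric X) (r : ℝ) :
    ∀ᶠ n : ℕ in cofinite, ∀ x ∈ (chaoticNerve X).nonDegenerate n,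
      r < length (X := X) (n := n) x := by
  obtain ⟨δ, hδ, hd⟩ := exists_pos_le_d hX
  rw [Nat.cofinite_eq_atTop]
  filter_upwards [(tendsto_natCast_atTop_atTop.atTop_mul_const
    (NNReal.coe_pos.2 hδ)).eventually_gt_atTop r] with n hn x hx
  exact hn.trans_le (by exact_mod_cast nsmul_eq_mul n δ ▸ nsmul_le_length hd hx)

end Lengths

section Coproducts

variable {R : Type*} [Ring R] {ι : Type u} (Z : ι → ModuleCat.{u} R)

instance free_sigma [∀ i, Module.Free R (Z i)] : Module.Free R (∐ Z : ModuleCat.{u} R) := by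
  classical
  exact Module.Free.of_equiv (ModuleCat.coprodIsoDirectSum Z).toLinearEquiv.symm

instance finite_sigma [Finite ι] [∀ i, Module.Finite R (Z i)] :
    Module.Finite R (∐ Z : ModuleCat.{u} R) := by
  classical
  exact Module.Finite.equiv (ModuleCat.coprodIsoDirectSum Z).toLinearEquiv.symm

lemma finrank_sigma [StrongRankCondition R] [Fintype ι] [∀ i, Module.Free R (Z i)]
    [∀ i, Module.Finite R (Z i)] :
    Module.finrank R (∐ Z : ModuleCat.{u} R) = ∑ i, Module.finrank R (Z i) := by
  classical
  rw [(ModuleCat.coprodIsoDirectSum Z).toLinearEquiv.finrank_eq]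
  exact Module.finrank_directSum R fun i => Z i

end Coproducts

section Weights

lemma stabilization_obj_of_eq {ℓ : ℝ≥0ᵒᵖ} {k : ℝ} (h : (ℓ.unop : ℝ) = k) :
    stabilization.{u}.obj ℓ k = ModuleCat.of ℤ (ULift.{u} ℤ) :=
  if_pos h

lemma stabilization_obj_of_ne {ℓ : ℝ≥0ᵒᵖ} {k : ℝ} (h : (ℓ.unop : ℝ) ≠ k) :
    stabilization.{u}.obj ℓ k = ModuleCat.of ℤ PUnit.{u + 1} :=
  if_neg h

instance free_stabilization_obj (ℓ : ℝ≥0ᵒᵖ) (k : ℝ) :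
    Module.Free ℤ (stabilization.{u}.obj ℓ k) := by
  by_cases h : (ℓ.unop : ℝ) = k
  · exact stabilization_obj_of_eq h ▸ inferInstanceAs (Module.Free ℤ (ULift.{u} ℤ))
  · exact stabilization_obj_of_ne h ▸ inferInstanceAs (Module.Free ℤ PUnit.{u + 1})

instance finite_stabilization_obj (ℓ : ℝ≥0ᵒᵖ) (k : ℝ) :
    Module.Finite ℤ (stabilization.{u}.obj ℓ k) := by
  by_cases h : (ℓ.unop : ℝ) = k
  · exact stabilization_obj_of_eq h ▸ inferInstanceAs (Module.Finite ℤ (ULift.{u} ℤ))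
  · exact stabilization_obj_of_ne h ▸ inferInstanceAs (Module.Finite ℤ PUnit.{u + 1})

lemma coeff_single_eq_finrank_stabilization_obj (ℓ : ℝ≥0ᵒᵖ) (k : ℝ) :
    (HahnSeries.single (ℓ.unop : ℝ) (1 : ℚ)).coeff k =
      Module.finrank ℤ (stabilization.{u}.obj ℓ k) := by
  by_cases h : (ℓ.unop : ℝ) = k
  · rw [stabilization_obj_of_eq h, h, HahnSeries.coeff_single_same]
    simp [ULift.moduleEquiv.finrank_eq]
  · rw [stabilization_obj_of_ne h, HahnSeries.coeff_single_of_ne (Ne.symm h)]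
    simp [Module.finrank_zero_of_subsingleton]

variable {X : Type u} [QuasiPseudoMetric X]

instance free_barSummand_obj (e : (chaoticNerve X).Elements) (ℓ : ℝ) :
    Module.Free ℤ ((barSummand X).obj e ℓ) :=
  free_stabilization_obj _ ℓ

instance finite_barSummand_obj (e : (chaoticNerve X).Elements) (ℓ : ℝ) :
    Module.Finite ℤ ((barSummand X).obj e ℓ) :=
  finite_stabilization_obj _ ℓ

instance free_barSummand_comp_eval_obj (ℓ : ℝ) (e : (chaoticNerve X).Elements) :
    Module.Free ℤ ((barSummand X ⋙ GradedObject.eval ℓ).obj e) :=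
  free_barSummand_obj e ℓ

instance finite_barSummand_comp_eval_obj (ℓ : ℝ) (e : (chaoticNerve X).Elements) :
    Module.Finite ℤ ((barSummand X ⋙ GradedObject.eval ℓ).obj e) :=
  finite_barSummand_obj e ℓ

variable {n : ℕ} {x : Fin (n + 1) → X}

lemma coeff_single_length_eq_finrank_barSummand_obj (x : Fin (n + 1) → X) (ℓ : ℝ) :
    (HahnSeries.single (length x : ℝ) (1 : ℚ)).coeff ℓ =
      Module.finrank ℤ ((barSummand X).obj (tuple x) ℓ) :=
  coeff_single_eq_finrank_stabilization_obj _ ℓ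

lemma hasHahnEulerChar_tupleObj (x : Fin (n + 1) → X) :
    HasHahnEulerChar (tupleObj x) (HahnSeries.single (length x : ℝ) 1) :=
  hasHahnEulerChar_inDegreeZero (coeff_single_length_eq_finrank_barSummand_obj x)

lemma hasHahnEulerChar_tupleLatching_of_degenerate (hx : x ∈ (chaoticNerve X).degenerate n) :
    HasHahnEulerChar (tupleLatching x) (HahnSeries.single (length x : ℝ) 1) := by
  let e (ℓ : ℝ) : (barSummand X).obj (tuple x) ℓ ≃ₗ[ℤ]
      (latchingObj (CategoryOfElements.π (chaoticNerve X))
        (barSummand X ⋙ GradedObject.eval ℓ) (tuple x) : ModuleCat ℤ) :=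
    have : IsIso (latchingMap _ (barSummand X ⋙ GradedObject.eval ℓ) (tuple x)) :=
      isIso_latchingMap (invertsDegeneracies_barSummand ℓ) hx
    (asIso (latchingMap _ (barSummand X ⋙ GradedObject.eval ℓ) (tuple x))).toLinearEquiv.symm
  have := fun ℓ => Module.Free.of_equiv (e ℓ)
  have := fun ℓ => Module.Finite.equiv (e ℓ)
  refine hasHahnEulerChar_inDegreeZero fun ℓ => ?_
  rw [coeff_single_length_eq_finrank_barSummand_obj, (e ℓ).finrank_eq]

lemma hasHahnEulerChar_tupleLatching_of_nonDegenerate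
    (hx : x ∈ (chaoticNerve X).nonDegenerate n) : HasHahnEulerChar (tupleLatching x) 0 := by
  have (ℓ : ℝ) : Subsingleton (latchingObj (CategoryOfElements.π (chaoticNerve X))
      (barSummand X ⋙ GradedObject.eval ℓ) (tuple x) : ModuleCat.{u} ℤ) :=
    ModuleCat.subsingleton_of_isZero ((isZero_zero _).of_iso
      ((latchingObjIsInitial hx).uniqueUpToIso HasZeroObject.zeroIsInitial))
  exact hasHahnEulerChar_inDegreeZero fun ℓ => by simp [Module.finrank_zero_of_subsingleton]

lemma isHahnFinite_tupleLatching (x : Fin (n + 1) → X) : IsHahnFinite (tupleLatching x) := by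
  by_cases hx : x ∈ (chaoticNerve X).degenerate n
  · exact (hasHahnEulerChar_tupleLatching_of_degenerate hx).isHahnFinite
  · exact (hasHahnEulerChar_tupleLatching_of_nonDegenerate hx).isHahnFinite

lemma weight_of_degenerate (hx : x ∈ (chaoticNerve X).degenerate n) : weight x = 0 := by
  rw [weight, (hasHahnEulerChar_tupleObj x).hahnEulerChar_eq,
    (hasHahnEulerChar_tupleLatching_of_degenerate hx).hahnEulerChar_eq, sub_self]

lemma weight_of_nonDegenerate (hx : x ∈ (chaoticNerve X).nonDegenerate n) :
    weight x = HahnSeries.single (length x : ℝ) 1 := by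
  rw [weight, (hasHahnEulerChar_tupleObj x).hahnEulerChar_eq,
    (hasHahnEulerChar_tupleLatching_of_nonDegenerate hx).hahnEulerChar_eq, sub_zero]

end Weights

section Convergence

variable {X : Type u} [QuasiPseudoMetric X]

/-- The group of `n`-chains of the realized magnitude nerve, as the coproduct of the summands of
the nondegenerate tuples. -/
noncomputable def realizedMagnitudeNerveXIso (ℓ : ℝ) (n : ℕ) :
    (realizedMagnitudeNerve X ℓ).X n ≅
      nonDegenerateCoproduct (S := chaoticNerve X) (barSummand X ⋙ GradedObject.eval ℓ) n :=
  cokernelLatchingIso (invertsDegeneracies_barSummand (X := X) ℓ) n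

instance free_realizedMagnitudeNerve_X (ℓ : ℝ) (n : ℕ) :
    Module.Free ℤ ((realizedMagnitudeNerve X ℓ).X n) :=
  Module.Free.of_equiv (realizedMagnitudeNerveXIso ℓ n).toLinearEquiv.symm

instance finite_chaoticNerve_obj [Finite X] (n : ℕ) : Finite ((chaoticNerve X) _⦋n⦌) :=
  inferInstanceAs (Finite (Fin (n + 1) → X))

instance finite_realizedMagnitudeNerve_X [Finite X] (ℓ : ℝ) (n : ℕ) :
    Module.Finite ℤ ((realizedMagnitudeNerve X ℓ).X n) :=
  Module.Finite.equiv (realizedMagnitudeNerveXIso ℓ n).toLinearEquiv.symm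

lemma finrank_realizedMagnitudeNerve_X [Fintype X] (ℓ : ℝ) (n : ℕ) :
    (Module.finrank ℤ ((realizedMagnitudeNerve X ℓ).X n) : ℚ) =
      (∑ x : Fin (n + 1) → X, weight x).coeff ℓ := by
  have := Fintype.ofFinite ((chaoticNerve X).nonDegenerate n)
  rw [(realizedMagnitudeNerveXIso ℓ n).toLinearEquiv.finrank_eq, finrank_sigma,
    HahnSeries.coeff_sum, Nat.cast_sum]
  refine Fintype.sum_of_injective (ι := (chaoticNerve X).nonDegenerate n)
    (κ := Fin (n + 1) → X) Subtype.val Subtype.val_injective _ _ (fun x hx => ?_) fun x => ?_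
  · have hx' : x ∈ (chaoticNerve X).degenerate n := by_contra fun h => hx ⟨⟨x, h⟩, rfl⟩
    rw [weight_of_degenerate hx', HahnSeries.coeff_zero]
  · rw [weight_of_nonDegenerate x.2]
    exact (coeff_single_length_eq_finrank_barSummand_obj x.1 ℓ).symm

lemma eventually_lt_orderTop_sum_weight [Finite X] (hX : IsQuasiMetric X)
    (T : ∀ n : ℕ, Finset (Fin (n + 1) → X)) (r : ℝ) :
    ∀ᶠ n in cofinite, (r : WithTop ℝ) < ((-1) ^ n * ∑ x ∈ T n, weight x).orderTop := by
  filter_upwards [eventually_lt_length hX r] with n hn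
  rw [orderTop_neg_one_pow_mul]
  refine AddValuation.map_lt_sum (HahnSeries.addVal ℝ ℚ) WithTop.coe_ne_top fun x _ => ?_
  rw [HahnSeries.addVal_apply]
  by_cases hx : x ∈ (chaoticNerve X).nonDegenerate n
  · rw [weight_of_nonDegenerate hx, HahnSeries.orderTop_single one_ne_zero]
    exact_mod_cast hn x hx
  · rw [weight_of_degenerate (not_not.1 hx), HahnSeries.orderTop_zero]
    exact WithTop.coe_lt_top r

/-- The terms `(-1) ^ n * ∑ x ∈ T n, weight x` of a magnitude series, restricted in degree `n` to
the tuples in `T n`, as a summable family of Hahn series. -/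
noncomputable def weightSeries [Finite X] (hX : IsQuasiMetric X)
    (T : ∀ n : ℕ, Finset (Fin (n + 1) → X)) : HahnSeries.SummableFamily ℝ ℚ ℕ :=
  summableFamilyOfOrderTop (fun n => (-1) ^ n * ∑ x ∈ T n, weight x)
    (eventually_lt_orderTop_sum_weight hX T)

lemma tendsto_sum_weight [Finite X] (hX : IsQuasiMetric X)
    (T : ∀ n : ℕ, Finset (Fin (n + 1) → X)) :
    Tendsto (fun N : ℕ => ∑ n ∈ Finset.range N, (-1) ^ n * ∑ x ∈ T n, weight x) atTop
      (𝓝 (weightSeries hX T).hsum) :=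
  (hasSum_hsum (s := weightSeries hX T)
    (eventually_lt_orderTop_sum_weight hX T)).tendsto_sum_nat

lemma hasHahnEulerChar_realizedMagnitudeNerve [Fintype X] (hX : IsQuasiMetric X) :
    HasHahnEulerChar (realizedMagnitudeNerve X)
      (weightSeries hX fun _ => Finset.univ).hsum :=
  hasHahnEulerChar_hsum fun n ℓ => by
    rw [finrank_realizedMagnitudeNerve_X]
    exact coeff_neg_one_pow_mul n _ ℓ

end Convergence

end MagnitudeHomology

theorem mainTheorem11 {X : Type u} [Fintype X] [MagnitudeHomology.QuasiPseudoMetric X]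
    (hX : MagnitudeHomology.IsQuasiMetric X) :
    MagnitudeHomology.HasConvergentMagnitudeEulerChar X := by
  have hB := MagnitudeHomology.hasHahnEulerChar_realizedMagnitudeNerve hX
  refine ⟨fun _ x => (MagnitudeHomology.hasHahnEulerChar_tupleObj x).isHahnFinite,
    fun _ x => MagnitudeHomology.isHahnFinite_tupleLatching x, hB.isHahnFinite,
    fun a b => ⟨_, MagnitudeHomology.tendsto_sum_weight hX _⟩, ?_⟩
  rw [hB.hahnEulerChar_eq]
  exact MagnitudeHomology.tendsto_sum_weight hX fun _ => Finset.univ
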